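/- **Theorem 5 (Ergodic capacity).** Let $I_1,I_2$ be independent random variables with the mixture Exponential-Generalized Gamma densities $$f_{I_i}(x)=\frac{\omega_i}{\lambda_i}e^{-x/\lambda_i}+(1-\omega_i)\frac{c_i\,x^{a_ic_i-1}}{b_i^{a_ic_i}\Gamma(a_i)}e^{-(x/b_i)^{c_i}},\qquad x>0,\ i=1,2,$$ where $0<\omega_i<1$ and $\lambda_i,a_i,b_i,c_i>0$. Let $r_1,r_2\in\{1,2\}$ ($1$ for heterodyne detection, $2$ for IM/DD), let $\eta,N_{0_1},N_{0_2}>0$, let $\gamma_i=(\eta I_i)^{r_i}/N_{0_i}$ be the SNR of hop $i$, and let $$\mu_i=\frac{\mathbb E[\gamma_i]}{\omega_i\lambda_i^{r_i}\Gamma(1+r_i)+(1-\omega_i)\,b_i^{r_i}\,\Gamma(a_i+r_i/c_i)/\Gamma(a_i)}$$ be its average electrical SNR (if the fading is normalized, $\mathbb E[I_i]=1$, this is $\mathbb E[\gamma_i]$ when $r_i=1$; the divisor is $2\omega_i\lambda_i^2+(1-\omega_i)b_i^2\Gamma(a_i+2/c_i)/\Gamma(a_i)$ when $r_i=2$). Let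 $C>0$, let $\gamma=\gamma_1\gamma_2/(\gamma_2+C)$ be the end-to-end SNR of the amplify-and-forward fixed-gain link, and let $\tau>0$ ($\tau=1$ for heterodyne detection, $\tau=e/(2\pi)$ for IM/DD). Then $\ln(1+\tau\gamma)$ is integrable, the four Fox $\mathrm H$ functions below are well defined, and the ergodic capacity is $$\begin{aligned}\mathbb E[\ln(1+\tau\gamma)]={}&\omega_1\omega_2\,\mathrm H\!\left[(1;1,1)\,\middle|\,\begin{matrix}(0,r_1)(1,1)\\(1,1)(0,1)\end{matrix}\,\middle|\,\begin{matrix}-\\(0,1)(1,r_2)\end{matrix}\,\middle|\,\tau\lambda_1^{r_1}\mu_1,\frac{C}{\lambda_2^{r_2}\mu_2}\right]\\ &+\frac{\omega_1(1-\omega_2)}{\Gamma(a_2)}\,\mathrm H\!\left[(1;1,1)\,\middle|\,\begin{matrix}(0,r_1)(1,1)\\(1,1)(0,1)\end{matrix}\,\middle|\,\begin{matrix}-\\(0,1)(a_2,\frac{r_2}{c_2})\end{matrix}\,\middle|\,\tau\lambda_1^{r_1}\mu_1,\frac{C}{b_2^{r_2}\mu_2}\right]\\ &+\frac{\omega_2(1-\omega_1)}{\Gamma(a_1)}\,\mathrm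 H\!\left[(1;1,1)\,\middle|\,\begin{matrix}(1,1)(1-a_1,\frac{r_1}{c_1})\\(1,1)(0,1)\end{matrix}\,\middle|\,\begin{matrix}-\\(0,1)(1,r_2)\end{matrix}\,\middle|\,\tau b_1^{r_1}\mu_1,\frac{C}{\lambda_2^{r_2}\mu_2}\right]\\ &+\frac{(1-\omega_1)(1-\omega_2)}{\Gamma(a_1)\Gamma(a_2)}\,\mathrm H\!\left[(1;1,1)\,\middle|\,\begin{matrix}(1,1)(1-a_1,\frac{r_1}{c_1})\\(1,1)(0,1)\end{matrix}\,\middle|\,\begin{matrix}-\\(0,1)(a_2,\frac{r_2}{c_2})\end{matrix}\,\middle|\,\tau b_1^{r_1}\mu_1,\frac{C}{b_2^{r_2}\mu_2}\right].\end{aligned}$$ Here $\mathrm H=\mathrm H^{0,1:1,2:2,0}_{1,0:2,2:0,2}$ is the bivariate Fox $\mathrm H$ function: for parameters $\left[(1;1,1)\,\middle|\,\begin{matrix}(e_1,E_1)(e_2,E_2)\\(1,1)(0,1)\end{matrix}\,\middle|\,\begin{matrix}-\\(d_1,D_1)(d_2,D_2)\end{matrix}\,\middle|\,x,y\right]$ it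 is $$\frac1{(2\pi i)^2}\int_{\mathcal C_1}\int_{\mathcal C_2}\Gamma(s+t)\,\frac{\Gamma(1-s)\,\Gamma(1-e_1+E_1s)\,\Gamma(1-e_2+E_2s)}{\Gamma(1+s)}\,\Gamma(d_1-D_1t)\,\Gamma(d_2-D_2t)\,x^s\,y^t\,dt\,ds,$$ where $\mathcal C_1,\mathcal C_2$ are vertical lines, directed upwards, in the $s$- and $t$-plane which separate the poles of the factors in the numerator, that is, on which $\Gamma(s+t)$, $\Gamma(1-s)$, $\Gamma(1-e_j+E_js)$ and $\Gamma(d_j-D_jt)$ all have arguments with positive real part. Well defined means that such lines exist, and that along all of them the double integral converges absolutely to the same value. -/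

import Mathlib

open MeasureTheory ProbabilityTheory

noncomputable section

/-! ### The Fox H function of two variables -/

/-- Parameters of the joint gamma factor of `H^{0,n:...}_{p,q:...}`: the upper triples
`(α_j; a_j, A_j)`, `j = 1, …, p`, the lower triples `(β_j; b_j, B_j)`, `j = 1, …, q`, and the
number `n` of upper triples whose gamma factor is in the numerator. -/
structure FoxHJointBlock (n p q : ℕ) where
  upper : Fin p → ℝ × ℝ × ℝ
  lower : Fin q → ℝ × ℝ × ℝ

/-- Parameters of a one-variable gamma factor with orders `m, n` and `p, q`: the upper pairs
`(c_j, γ_j)`, `j = 1, …, p`, of which the first `n` are in the numerator, and the lower pairs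
`(d_j, δ_j)`, `j = 1, …, q`, of which the first `m` are in the numerator. -/
structure FoxHBlock (m n p q : ℕ) where
  upper : Fin p → ℝ × ℝ
  lower : Fin q → ℝ × ℝ

/-- `∏_{j ≤ n} Γ(1 - α_j + a_j s + A_j t)` divided by
`∏_{n < j ≤ p} Γ(α_j - a_j s - A_j t) ∏_{j ≤ q} Γ(1 - β_j + b_j s + B_j t)`. -/
def FoxHJointBlock.kernel {n p q : ℕ} (J : FoxHJointBlock n p q) (s t : ℂ) : ℂ :=
  (∏ j : Fin p,
    if j.val < n then
      Complex.Gamma (1 - (J.upper j).1 + (J.upper j).2.1 * s + (J.upper j).2.2 * t)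
    else
      (Complex.Gamma ((J.upper j).1 - (J.upper j).2.1 * s - (J.upper j).2.2 * t))⁻¹) *
  ∏ j : Fin q,
    (Complex.Gamma (1 - (J.lower j).1 + (J.lower j).2.1 * s + (J.lower j).2.2 * t))⁻¹

/-- `∏_{j ≤ m} Γ(d_j - δ_j s) ∏_{j ≤ n} Γ(1 - c_j + γ_j s)` divided by
`∏_{m < j ≤ q} Γ(1 - d_j + δ_j s) ∏_{n < j ≤ p} Γ(c_j - γ_j s)`. -/
def FoxHBlock.kernel {m n p q : ℕ} (A : FoxHBlock m n p q) (s : ℂ) : ℂ :=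
  (∏ j : Fin q,
    if j.val < m then Complex.Gamma ((A.lower j).1 - (A.lower j).2 * s)
    else (Complex.Gamma (1 - (A.lower j).1 + (A.lower j).2 * s))⁻¹) *
  ∏ j : Fin p,
    if j.val < n then Complex.Gamma (1 - (A.upper j).1 + (A.upper j).2 * s)
    else (Complex.Gamma ((A.upper j).1 - (A.upper j).2 * s))⁻¹

/-- The line `Re s = σ` separates the poles of the numerator gamma factors: those of
`Γ(d_j - δ_j s)` lie to its right, those of `Γ(1 - c_j + γ_j s)` to its left
(the coefficients `δ_j`, `γ_j` of a Fox H function are positive). -/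
def FoxHBlock.Separates {m n p q : ℕ} (A : FoxHBlock m n p q) (σ : ℝ) : Prop :=
  (∀ j : Fin q, j.val < m → 0 < (A.lower j).1 - (A.lower j).2 * σ) ∧
  (∀ j : Fin p, j.val < n → 0 < 1 - (A.upper j).1 + (A.upper j).2 * σ)

/-- On the lines `Re s = σ`, `Re t = κ`, the poles of `Γ(1 - α_j + a_j s + A_j t)`, as a function of
either variable, lie to the left of the contour of that variable. -/
def FoxHJointBlock.Separates {n p q : ℕ} (J : FoxHJointBlock n p q) (σ κ : ℝ) : Prop :=
  ∀ j : Fin p, j.val < n →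
    0 < 1 - (J.upper j).1 + (J.upper j).2.1 * σ + (J.upper j).2.2 * κ

section Bivariate

variable {n₁ p₁ q₁ m₂ n₂ p₂ q₂ m₃ n₃ p₃ q₃ : ℕ}

/-- The integrand `φ(s, t) θ₂(s) θ₃(t) x ^ s y ^ t` at `s = σ + i u`, `t = κ + i v`. -/
def foxHIntegrand (J : FoxHJointBlock n₁ p₁ q₁) (A : FoxHBlock m₂ n₂ p₂ q₂)
    (B : FoxHBlock m₃ n₃ p₃ q₃) (x y σ κ : ℝ) (z : ℝ × ℝ) : ℂ :=
  let s : ℂ := σ + z.1 * Complex.I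
  let t : ℂ := κ + z.2 * Complex.I
  J.kernel s t * A.kernel s * B.kernel t * (x : ℂ) ^ s * (y : ℂ) ^ t

/-- `h` is the value at `(x, y)` of the bivariate Fox H function, i.e. of the Mellin–Barnes integral
`(2πi)⁻² ∫_{C₁} ∫_{C₂} φ(s, t) θ₂(s) θ₃(t) x ^ s y ^ t dt ds` over contours running from `-i∞` to
`+i∞` and separating the poles. The contours are vertical lines `Re s = σ`, `Re t = κ`, so that
`ds dt = i² du dv`; at least one separating pair of lines exists, and along every such pair the
double integral converges absolutely to `h`. -/
def IsBivariateFoxH (J : FoxHJointBlock n₁ p₁ q₁) (A : FoxHBlock m₂ n₂ p₂ q₂)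
    (B : FoxHBlock m₃ n₃ p₃ q₃) (x y : ℝ) (h : ℂ) : Prop :=
  (∃ σ κ : ℝ, J.Separates σ κ ∧ A.Separates σ ∧ B.Separates κ) ∧
  ∀ σ κ : ℝ, J.Separates σ κ → A.Separates σ → B.Separates κ →
    Integrable (foxHIntegrand J A B x y σ κ) (volume : Measure (ℝ × ℝ)) ∧
    (1 / (2 * Real.pi * Complex.I)) ^ 2 *
      (Complex.I ^ 2 * ∫ z : ℝ × ℝ, foxHIntegrand J A B x y σ κ z) = h

/-- The defining Mellin–Barnes integral exists. -/
def BivariateFoxHConverges (J : FoxHJointBlock n₁ p₁ q₁) (A : FoxHBlock m₂ n₂ p₂ q₂)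
    (B : FoxHBlock m₃ n₃ p₃ q₃) (x y : ℝ) : Prop :=
  ∃ h : ℂ, IsBivariateFoxH J A B x y h

open Classical in
/-- The bivariate Fox H function `H^{0,n₁:m₂,n₂:m₃,n₃}_{p₁,q₁:p₂,q₂:p₃,q₃}[J | A | B | x, y]`
(and `0` where the defining integral does not exist). -/
def bivariateFoxH (J : FoxHJointBlock n₁ p₁ q₁) (A : FoxHBlock m₂ n₂ p₂ q₂)
    (B : FoxHBlock m₃ n₃ p₃ q₃) (x y : ℝ) : ℂ :=
  if h : BivariateFoxHConverges J A B x y then h.choose else 0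

end Bivariate

/-! ### The parameter lists of the capacity formula -/

/-- `(1; 1, 1) | --` -/
def capacityJoint : FoxHJointBlock 1 1 0 := ⟨![(1, 1, 1)], ![]⟩

/-- `(0, r), (1, 1) | (1, 1), (0, 1)` -/
def capacityFirstExp (r : ℕ) : FoxHBlock 1 2 2 2 :=
  ⟨![(0, (r : ℝ)), (1, 1)], ![(1, 1), (0, 1)]⟩

/-- `(1, 1), (1 - a, r / c) | (1, 1), (0, 1)` -/
def capacityFirstGG (a c : ℝ) (r : ℕ) : FoxHBlock 1 2 2 2 :=
  ⟨![(1, 1), (1 - a, r / c)], ![(1, 1), (0, 1)]⟩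

/-- `-- | (0, 1), (1, r)` -/
def capacitySecondExp (r : ℕ) : FoxHBlock 2 0 0 2 :=
  ⟨![], ![(0, 1), (1, (r : ℝ))]⟩

/-- `-- | (0, 1), (a, r / c)` -/
def capacitySecondGG (a c : ℝ) (r : ℕ) : FoxHBlock 2 0 0 2 :=
  ⟨![], ![(0, 1), (a, r / c)]⟩

/-! ### The mixture Exponential-Generalized Gamma channel -/

/-- The density of the mixture Exponential-Generalized Gamma (EGG) distribution. -/
def eggPDF (ω lam a b c x : ℝ) : ℝ :=
  if 0 < x then
    ω / lam * Real.exp (-(x / lam)) +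
      (1 - ω) * (c * x ^ (a * c - 1) / (b ^ (a * c) * Real.Gamma a)) *
        Real.exp (-((x / b) ^ c))
  else 0

/-- The mixture EGG distribution. -/
def eggMeasure (ω lam a b c : ℝ) : Measure ℝ :=
  volume.withDensity fun x => ENNReal.ofReal (eggPDF ω lam a b c x)

/-- The instantaneous SNR `(η I) ^ r / N₀` of a hop with irradiance `I`. -/
def hopSNR (η N₀ : ℝ) (r : ℕ) (I : ℝ) : ℝ := (η * I) ^ r / N₀

/-- The average electrical SNR of a hop whose average SNR is `γbar`: the quotient of `γbar` by the
`r`-th moment `ω λ ^ r Γ(1 + r) + (1 - ω) b ^ r Γ(a + r / c) / Γ(a)` of the irradiance. For `r = 2`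
the divisor is `2 ω λ ^ 2 + b ^ 2 (1 - ω) Γ(a + 2 / c) / Γ(a)`; for `r = 1` it is the mean
irradiance, which is `1` (so that the value is `γbar`) when the fading is normalized. -/
def averageElectricalSNR (ω lam a b c : ℝ) (r : ℕ) (γbar : ℝ) : ℝ :=
  γbar / (ω * lam ^ r * Real.Gamma (1 + r) +
    (1 - ω) * b ^ r * (Real.Gamma (a + r / c) / Real.Gamma a))

/-- The end-to-end SNR of the dual-hop link with a fixed-gain relay. -/
def endToEndSNR (C γ₁ γ₂ : ℝ) : ℝ := γ₁ * γ₂ / (γ₂ + C)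

end

noncomputable section

/-! ### Bounds for the Gamma function on vertical lines -/

/-! Dividing by the second SNR turns the end-to-end SNR into `γ₁ / (1 + C / γ₂)`, so the capacity is
the mean of `log (1 + p / (1 + q))` with `p = τ γ₁` and `q = C / γ₂`. On lines with `0 < Re s < 1`,
`Re t < 0` and `Re (s + t) > 0`, this logarithm is the double Mellin–Barnes integral of `Γ(s + t)
Γ(1 - s) Γ(-t) / s * p ^ s * q ^ t` (`integral_capacityKernel_mul_cpow`). The fading now enters only
through powers of the irradiances.

For generalized Gamma fading the mean of `w ^ z` is `b ^ z Γ(a + z / c) / Γ(a)`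
(`integral_cpow_ggMeasure`). Averaging under the contour integral therefore inserts exactly the two
missing gamma factors of the Fox H kernel and scales its arguments (`isBivariateFoxH_capacityGG`).
Fubini applies because on vertical lines the modulus of a power depends only on the real part of its
exponent, while the kernel is absolutely integrable by the decay of Gamma
(`norm_Gamma_le_inv_one_add_sq`).

The exponential law is the generalized Gamma law with `a = c = 1`, so the product of the two
mixtures splits into four generalized Gamma products (`eggMeasure_eq_add`, `integral_mixture`), one
for each Fox H term. The divisor in the average electrical SNR is the `r`-th moment of the
irradiance, hence `μ = η ^ r / N₀` (`averageElectricalSNR_hopSNR`). -/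

lemma norm_Gamma_le_Gamma_re {z : ℂ} (hz : 0 < z.re) : ‖Complex.Gamma z‖ ≤ Real.Gamma z.re := by
  rw [Complex.Gamma_eq_integral hz, Real.Gamma_eq_integral hz, Complex.GammaIntegral]
  refine (norm_integral_le_integral_norm _).trans_eq ?_
  refine setIntegral_congr_fun measurableSet_Ioi fun x hx => ?_
  simp only [norm_mul]
  rw [Complex.norm_cpow_eq_rpow_re_of_pos hx, Complex.norm_real, Real.norm_eq_abs, Real.abs_exp]
  simp

lemma ne_neg_natCast_of_re_pos {z : ℂ} (hz : 0 < z.re) (m : ℕ) : z ≠ -m := by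
  rintro rfl
  simp only [Complex.neg_re, Complex.natCast_re] at hz
  linarith [Nat.cast_nonneg (α := ℝ) m]

/-- Two steps of the functional equation give `Γ(z + 2) = (z + 1) z Γ(z)`, and both linear factors
have modulus at least `|Im z|`. Quadratic decay is far from sharp but suffices for integrability on
vertical lines. -/
lemma norm_Gamma_le_inv_one_add_sq {z : ℂ} (hz : 0 < z.re) :
    ‖Complex.Gamma z‖ ≤ (Real.Gamma z.re + Real.Gamma (z.re + 2)) * (1 + z.im ^ 2)⁻¹ := by
  have h0 : z ≠ 0 := by rintro rfl; simp at hz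
  have h1 : z + 1 ≠ 0 := by
    intro h
    have := congrArg Complex.re h
    simp at this; linarith
  have e : Complex.Gamma (z + 2) = (z + 1) * (z * Complex.Gamma z) := by
    rw [← Complex.Gamma_add_one z h0, ← Complex.Gamma_add_one _ h1]; ring_nf
  have e2 : ‖Complex.Gamma (z + 2)‖ ≤ Real.Gamma (z.re + 2) := by
    have := norm_Gamma_le_Gamma_re (z := z + 2) (by simp; linarith)
    simpa using this
  rw [e, norm_mul, norm_mul] at e2
  have e3 := norm_Gamma_le_Gamma_re hz
  have e4 := Complex.abs_im_le_norm z
  have e5 : |z.im| ≤ ‖z + 1‖ := by simpa using Complex.abs_im_le_norm (z + 1)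
  have e6 : z.im ^ 2 ≤ ‖z + 1‖ * ‖z‖ := by
    rw [← sq_abs, sq]; exact mul_le_mul e5 e4 (abs_nonneg _) (norm_nonneg _)
  rw [← div_eq_mul_inv, le_div_iff₀ (by positivity)]
  have := mul_le_mul_of_nonneg_right e6 (norm_nonneg (Complex.Gamma z))
  nlinarith

lemma Continuous.Gamma_of_re_pos {X : Type*} [TopologicalSpace X] {f : X → ℂ} (hf : Continuous f)
    (h : ∀ x, 0 < (f x).re) : Continuous fun x => Complex.Gamma (f x) :=
  continuous_iff_continuousAt.2 fun x =>
    (Complex.continuousAt_Gamma _ (ne_neg_natCast_of_re_pos (h x))).comp hf.continuousAt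

lemma Continuous.ofReal_const_cpow {X : Type*} [TopologicalSpace X] {f : X → ℂ} {w : ℝ}
    (hw : 0 < w) (hf : Continuous f) : Continuous fun x => (w : ℂ) ^ f x :=
  hf.const_cpow (Or.inl (Complex.ofReal_ne_zero.2 hw.ne'))

lemma integrable_Gamma_vertical {σ : ℝ} (hσ : 0 < σ) :
    Integrable fun u : ℝ => Complex.Gamma (σ + u * Complex.I) := by
  refine Integrable.mono' (integrable_inv_one_add_sq.const_mul
    (Real.Gamma σ + Real.Gamma (σ + 2))) ?_ ?_
  · exact (Continuous.Gamma_of_re_pos (by fun_prop) (by simp [hσ])).aestronglyMeasurable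
  · refine Filter.Eventually.of_forall fun u => ?_
    simpa using norm_Gamma_le_inv_one_add_sq (z := σ + u * Complex.I) (by simp [hσ])

lemma integrable_Gamma_neg_vertical {κ : ℝ} (hκ : κ < 0) :
    Integrable fun v : ℝ => Complex.Gamma (-(κ + v * Complex.I)) := by
  have := (integrable_Gamma_vertical (neg_pos.2 hκ)).comp_neg
  refine this.congr (Filter.Eventually.of_forall fun v => ?_)
  simp only; congr 1; push_cast; ring

/-! ### Mellin–Barnes integrals -/

/-- Mellin inversion for `exp (-x)`, whose Mellin transform is Gamma. -/
lemma integral_Gamma_neg_mul_cpow {κ y : ℝ} (hκ : κ < 0) (hy : 0 < y) :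
    ∫ v : ℝ, Complex.Gamma (-(κ + v * Complex.I)) * (y : ℂ) ^ ((κ : ℂ) + v * Complex.I) =
      2 * Real.pi * Real.exp (-y) := by
  have hg : mellin (fun x : ℝ => ((Real.exp (-x) : ℝ) : ℂ)) = Complex.GammaIntegral :=
    Complex.GammaIntegral_eq_mellin.symm
  have hc : MellinConvergent (fun x : ℝ => ((Real.exp (-x) : ℝ) : ℂ)) ((-κ : ℝ) : ℂ) := by
    have := Complex.GammaIntegral_convergent (s := ((-κ : ℝ) : ℂ)) (by simpa using hκ)
    refine this.congr_fun (fun x _ => ?_) measurableSet_Ioi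
    simp [mul_comm]
  have hG : ∀ v : ℝ, mellin (fun x : ℝ => ((Real.exp (-x) : ℝ) : ℂ)) (((-κ : ℝ) : ℂ) +
      v * Complex.I) = Complex.Gamma (((-κ : ℝ) : ℂ) + v * Complex.I) := fun v => by
    rw [hg, ← Complex.Gamma_eq_integral (by simpa using hκ)]
  have := mellinInv_mellin_eq (-κ) (fun x : ℝ => ((Real.exp (-x) : ℝ) : ℂ)) hy hc
    ((integrable_Gamma_vertical (neg_pos.2 hκ)).congr (.of_forall fun v => (hG v).symm))
    (by fun_prop)
  rw [mellinInv] at this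
  simp_rw [hG] at this
  -- Inversion runs along `Re s = -κ` with `y ^ (-s)`; reversing `v` substitutes `s = -t`.
  rw [← integral_neg_eq_self] at this
  rw [← this, Complex.real_smul, ← mul_assoc]
  push_cast
  rw [mul_one_div_cancel (by simp [Real.pi_ne_zero]), one_mul]
  refine integral_congr_ae (.of_forall fun v => ?_)
  simp only [smul_eq_mul]
  rw [mul_comm]
  congr 2 <;> ring

lemma integral_cpow_mul_exp {s : ℂ} (hs : 0 < s.re) {a : ℝ} (ha : 0 < a) :
    ∫ x : ℝ in Set.Ioi 0, (x : ℂ) ^ (s - 1) * ((Real.exp (-(a * x)) : ℝ) : ℂ) =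
      (a : ℂ) ^ (-s) * Complex.Gamma s := by
  have := Complex.integral_cpow_mul_exp_neg_mul_Ioi (a := s) (r := a) hs (by simpa using ha)
  rw [one_div, Complex.inv_cpow _ _ (by rw [Complex.arg_ofReal_of_nonneg ha.le]; positivity),
    ← Complex.cpow_neg] at this
  rw [← this]
  push_cast
  rfl

lemma integrableOn_cpow_mul_exp {s : ℂ} (hs : 0 < s.re) :
    IntegrableOn (fun x : ℝ => (x : ℂ) ^ (s - 1) * ((Real.exp (-x) : ℝ) : ℂ)) (Set.Ioi 0) := by
  refine (Complex.GammaIntegral_convergent hs).congr_fun (fun x _ => ?_) measurableSet_Ioi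
  simp [mul_comm]

/-- Expand `exp (-w y)` by the previous formula and integrate it against `y ^ (s - 1) exp (-y)`.
Carried out first in `v`, the integral is that of `y ^ (s - 1) exp (-(1 + w) y)`; carried out first
in `y`, it produces `Γ(s + t)`. -/
lemma integral_Gamma_neg_mul_Gamma_add_mul_cpow {s : ℂ} {κ w : ℝ} (hκ : κ < 0)
    (hs : 0 < s.re + κ) (hw : 0 < w) :
    ∫ v : ℝ, Complex.Gamma (-(κ + v * Complex.I)) * Complex.Gamma (s + (κ + v * Complex.I)) *
        (w : ℂ) ^ ((κ : ℂ) + v * Complex.I) =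
      2 * Real.pi * Complex.Gamma s * ((1 + w : ℝ) : ℂ) ^ (-s) := by
  have hs0 : 0 < s.re := by linarith
  set F : ℝ → ℝ → ℂ := fun y v => Complex.Gamma (-(κ + v * Complex.I)) *
    ((w * y : ℝ) : ℂ) ^ ((κ : ℂ) + v * Complex.I) * ((y : ℂ) ^ (s - 1) *
      ((Real.exp (-y) : ℝ) : ℂ)) with hF
  have hF' : ∀ y ∈ Set.Ioi (0 : ℝ), ∀ v, F y v = (y : ℂ) ^ ((s + (κ + v * Complex.I)) - 1) *
      ((Real.exp (-y) : ℝ) : ℂ) * (Complex.Gamma (-(κ + v * Complex.I)) *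
      (w : ℂ) ^ ((κ : ℂ) + v * Complex.I)) := by
    intro y hy v
    have hy' : (y : ℂ) ≠ 0 := Complex.ofReal_ne_zero.2 (ne_of_gt hy)
    simp only [hF]
    rw [Complex.ofReal_mul, Complex.mul_cpow_ofReal_nonneg hw.le (le_of_lt hy),
      show s + (κ + v * Complex.I) - 1 = (s - 1) + (κ + v * Complex.I) by ring,
      Complex.cpow_add (s - 1) _ hy']
    ring
  have hint : Integrable (Function.uncurry F) ((volume.restrict (Set.Ioi 0)).prod volume) := by
    have h1 := (integrableOn_cpow_mul_exp (s := s + κ) (by simpa using hs)).norm.mul_prod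
      ((integrable_Gamma_neg_vertical hκ).norm.mul_const (w ^ κ))
    refine Integrable.mono' h1 ?_ ?_
    · refine Measurable.aestronglyMeasurable ?_
      have hG : Measurable fun v : ℝ => Complex.Gamma (-(κ + v * Complex.I)) :=
        (Continuous.Gamma_of_re_pos (by fun_prop) (by simp [hκ])).measurable
      simp only [hF, Function.uncurry_def]
      exact ((hG.comp measurable_snd).mul (by fun_prop)).mul (by fun_prop)
    · have : ∀ᵐ z ∂((volume.restrict (Set.Ioi (0 : ℝ))).prod (volume : Measure ℝ)),
          z.1 ∈ Set.Ioi (0 : ℝ) :=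
        Measure.quasiMeasurePreserving_fst.ae (ae_restrict_mem measurableSet_Ioi)
      filter_upwards [this] with z hz
      show ‖F z.1 z.2‖ ≤ _
      rw [hF' _ hz]
      have hz' : (0 : ℝ) < z.1 := hz
      simp only [norm_mul, Complex.norm_cpow_eq_rpow_re_of_pos hz',
        Complex.norm_cpow_eq_rpow_re_of_pos hw]
      simp
  have hswap := integral_integral_swap hint
  have hL : ∀ y ∈ Set.Ioi (0 : ℝ), ∫ v, F y v = 2 * Real.pi *
      ((y : ℂ) ^ (s - 1) * ((Real.exp (-((1 + w) * y)) : ℝ) : ℂ)) := by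
    intro y hy
    simp only [hF]
    rw [integral_mul_const, integral_Gamma_neg_mul_cpow hκ (mul_pos hw hy),
      show -((1 + w) * y) = -(w * y) + -y by ring, Real.exp_add]
    push_cast
    ring
  have hR : ∀ v : ℝ, ∫ y in Set.Ioi 0, F y v = Complex.Gamma (-(κ + v * Complex.I)) *
      Complex.Gamma (s + (κ + v * Complex.I)) * (w : ℂ) ^ ((κ : ℂ) + v * Complex.I) := by
    intro v
    rw [setIntegral_congr_fun measurableSet_Ioi (fun y hy => hF' y hy v), integral_mul_const]
    have := integral_cpow_mul_exp (s := s + (κ + v * Complex.I)) (by simpa using hs) one_pos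
    simp only [one_mul] at this
    rw [this]
    simp
    ring
  simp_rw [hR] at hswap
  rw [← hswap, setIntegral_congr_fun measurableSet_Ioi hL, integral_const_mul,
    integral_cpow_mul_exp hs0 (by linarith)]
  ring

/-- The logarithm is the integral of `1 / (1 + w)` over `(0, z]`. Integrating the Mellin–Barnes
formula for `1 / (1 + w)` term by term turns `w ^ (s - 1)` into `z ^ s / s`. -/
lemma integral_Gamma_mul_cpow_eq_log {σ z : ℝ} (hσ : 0 < σ) (hσ1 : σ < 1) (hz : 0 < z) :
    ∫ u : ℝ, Complex.Gamma (1 - (σ + u * Complex.I)) * Complex.Gamma (σ + u * Complex.I) /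
        (σ + u * Complex.I) * (z : ℂ) ^ ((σ : ℂ) + u * Complex.I) =
      2 * Real.pi * (Real.log (1 + z) : ℝ) := by
  set G : ℝ → ℂ := fun u => Complex.Gamma (1 - (σ + u * Complex.I)) *
    Complex.Gamma (σ + u * Complex.I) with hG
  set F : ℝ → ℝ → ℂ := fun w u => G u * (w : ℂ) ^ ((σ : ℂ) + u * Complex.I - 1) with hF
  have hGc : Continuous G :=
    (Continuous.Gamma_of_re_pos (by fun_prop) (by simp [hσ1])).mul
      (Continuous.Gamma_of_re_pos (by fun_prop) (by simp [hσ]))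
  have hGi : Integrable G := by
    refine (integrable_Gamma_vertical hσ).bdd_mul (c := Real.Gamma (1 - σ))
      (Continuous.Gamma_of_re_pos (by fun_prop) (by simp [hσ1])).aestronglyMeasurable
      (.of_forall fun u => ?_)
    simpa using norm_Gamma_le_Gamma_re (z := 1 - (σ + u * Complex.I)) (by simp [hσ1])
  have hint : Integrable (Function.uncurry F) ((volume.restrict (Set.Ioc 0 z)).prod volume) := by
    have h0 : IntegrableOn (fun w : ℝ => w ^ (σ - 1)) (Set.Ioc 0 z) :=
      (intervalIntegrable_iff_integrableOn_Ioc_of_le hz.le).1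
        (intervalIntegral.intervalIntegrable_rpow' (by linarith))
    refine Integrable.mono' (h0.mul_prod hGi.norm) ?_ ?_
    · refine Measurable.aestronglyMeasurable ?_
      simp only [hF, Function.uncurry_def]
      exact (hGc.measurable.comp measurable_snd).mul (by fun_prop)
    · have : ∀ᵐ x ∂((volume.restrict (Set.Ioc (0 : ℝ) z)).prod (volume : Measure ℝ)),
          x.1 ∈ Set.Ioc (0 : ℝ) z :=
        Measure.quasiMeasurePreserving_fst.ae (ae_restrict_mem measurableSet_Ioc)
      filter_upwards [this] with x hx
      simp only [hF, Function.uncurry_def, norm_mul, Complex.norm_cpow_eq_rpow_re_of_pos hx.1]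
      simp [mul_comm]
  have hswap := integral_integral_swap hint
  have hL : ∀ w ∈ Set.Ioc (0 : ℝ) z, ∫ u, F w u = 2 * Real.pi * (((1 + w)⁻¹ : ℝ) : ℂ) := by
    intro w hw
    -- The binomial formula with exponent `1`, its contour variable being `t = s - 1`.
    have := integral_Gamma_neg_mul_Gamma_add_mul_cpow (s := 1) (κ := σ - 1) (w := w)
      (by linarith) (by simpa using hσ) hw.1
    rw [Complex.Gamma_one, mul_one, Complex.cpow_neg_one] at this
    rw [Complex.ofReal_inv, ← this]
    refine integral_congr_ae (.of_forall fun u => ?_)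
    simp only [hF, hG]
    push_cast
    congr 3 <;> ring_nf
  have hR : ∀ u : ℝ, ∫ w in Set.Ioc 0 z, F w u = G u /
        (σ + u * Complex.I) * (z : ℂ) ^ ((σ : ℂ) + u * Complex.I) := by
    intro u
    simp only [hF]
    rw [integral_const_mul, ← intervalIntegral.integral_of_le hz.le,
      integral_cpow (Or.inl (by simp [hσ])), sub_add_cancel, Complex.ofReal_zero,
      Complex.zero_cpow, sub_zero]
    · ring
    · intro h
      have := congrArg Complex.re h
      simp at this; linarith
  simp_rw [hR] at hswap
  rw [← hswap, setIntegral_congr_fun measurableSet_Ioc hL, integral_const_mul,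
    integral_complex_ofReal,
    ← intervalIntegral.integral_of_le hz.le]
  congr 2
  have := intervalIntegral.integral_comp_add_left (a := 0) (b := z) (fun x : ℝ => x⁻¹) 1
  rw [this, integral_inv_of_pos (by norm_num) (by linarith)]
  simp

/-- The factor of the capacity kernels that does not depend on the fading. -/
def capacityKernel (s t : ℂ) : ℂ :=
  Complex.Gamma (s + t) * (Complex.Gamma (1 - s) / s) * Complex.Gamma (-t)

lemma integrable_capacityKernel {σ κ : ℝ} (hσ : 0 < σ) (hσ1 : σ < 1) (hκ : κ < 0)
    (hσκ : 0 < σ + κ) :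
    Integrable fun z : ℝ × ℝ =>
      capacityKernel (σ + z.1 * Complex.I) (κ + z.2 * Complex.I) := by
  have h1 : Integrable fun u : ℝ => Complex.Gamma (1 - (σ + u * Complex.I)) := by
    have := (integrable_Gamma_vertical (sub_pos.2 hσ1)).comp_neg
    refine this.congr (.of_forall fun v => ?_)
    simp only; congr 1; push_cast; ring
  have hne : ∀ u : ℝ, (σ : ℂ) + u * Complex.I ≠ 0 := by
    intro u h
    have := congrArg Complex.re h
    simp at this; linarith
  have h2 : Integrable fun u : ℝ => Complex.Gamma (1 - (σ + u * Complex.I)) /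
      (σ + u * Complex.I) := by
    simp_rw [div_eq_mul_inv]
    refine h1.mul_bdd (c := σ⁻¹) (Continuous.inv₀ (by fun_prop) hne).aestronglyMeasurable
      (.of_forall fun u => ?_)
    rw [norm_inv]
    refine inv_anti₀ hσ ?_
    simpa [abs_of_pos hσ] using Complex.abs_re_le_norm ((σ : ℂ) + u * Complex.I)
  have h3 := (h2.mul_prod (integrable_Gamma_neg_vertical hκ))
  have hc : Continuous fun z : ℝ × ℝ => Complex.Gamma ((σ + z.1 * Complex.I) +
      (κ + z.2 * Complex.I)) :=
    Continuous.Gamma_of_re_pos (by fun_prop) (by simp [hσκ])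
  -- `Γ(s + t)` couples the variables but is bounded by `Γ(σ + κ)`; the remaining factors form a
  -- product of integrable functions.
  refine (h3.bdd_mul (c := Real.Gamma (σ + κ)) hc.aestronglyMeasurable
    (.of_forall fun z => ?_)).congr (.of_forall fun z => ?_)
  · simpa using norm_Gamma_le_Gamma_re
      (z := (σ + z.1 * Complex.I) + (κ + z.2 * Complex.I)) (by simp [hσκ])
  · simp only [capacityKernel]; ring

lemma integrable_capacityKernel_mul_cpow {σ κ p q : ℝ} (hσ : 0 < σ) (hσ1 : σ < 1) (hκ : κ < 0)
    (hσκ : 0 < σ + κ) (hp : 0 < p) (hq : 0 < q) :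
    Integrable fun z : ℝ × ℝ =>
      capacityKernel (σ + z.1 * Complex.I) (κ + z.2 * Complex.I) *
        ((p : ℂ) ^ ((σ : ℂ) + z.1 * Complex.I) * (q : ℂ) ^ ((κ : ℂ) + z.2 * Complex.I)) := by
  refine (integrable_capacityKernel hσ hσ1 hκ hσκ).mul_bdd (c := p ^ σ * q ^ κ)
    ((Continuous.ofReal_const_cpow hp (by fun_prop)).mul
      (Continuous.ofReal_const_cpow hq (by fun_prop))).aestronglyMeasurable
    (.of_forall fun z => ?_)
  rw [norm_mul, Complex.norm_cpow_eq_rpow_re_of_pos hp, Complex.norm_cpow_eq_rpow_re_of_pos hq]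
  simp

lemma integral_capacityKernel_mul_cpow {σ κ p q : ℝ} (hσ : 0 < σ) (hσ1 : σ < 1) (hκ : κ < 0)
    (hσκ : 0 < σ + κ) (hp : 0 < p) (hq : 0 < q) :
    ∫ z : ℝ × ℝ, capacityKernel (σ + z.1 * Complex.I) (κ + z.2 * Complex.I) *
        ((p : ℂ) ^ ((σ : ℂ) + z.1 * Complex.I) * (q : ℂ) ^ ((κ : ℂ) + z.2 * Complex.I)) =
      (2 * Real.pi) ^ 2 * (Real.log (1 + p / (1 + q)) : ℝ) := by
  have hint := integrable_capacityKernel_mul_cpow hσ hσ1 hκ hσκ hp hq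
  rw [Measure.volume_eq_prod] at hint ⊢
  rw [integral_prod _ hint]
  have hpq : 0 < p / (1 + q) := by positivity
  have hin : ∀ u : ℝ, ∫ v : ℝ, capacityKernel (σ + u * Complex.I) (κ + v * Complex.I) *
        ((p : ℂ) ^ ((σ : ℂ) + u * Complex.I) * (q : ℂ) ^ ((κ : ℂ) + v * Complex.I)) =
      2 * Real.pi * (Complex.Gamma (1 - (σ + u * Complex.I)) * Complex.Gamma (σ + u * Complex.I) /
        (σ + u * Complex.I) * ((p / (1 + q) : ℝ) : ℂ) ^ ((σ : ℂ) + u * Complex.I)) := by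
    -- For fixed `s` the `t`-integral gives `Γ(s) (1 + q) ^ (-s)`, which merges with `p ^ s` into a
    -- power of `p / (1 + q)`.
    intro u
    have h := integral_Gamma_neg_mul_Gamma_add_mul_cpow (s := σ + u * Complex.I) hκ
      (by simpa using hσκ) hq
    have h' : ((p / (1 + q) : ℝ) : ℂ) ^ ((σ : ℂ) + u * Complex.I) =
        (p : ℂ) ^ ((σ : ℂ) + u * Complex.I) *
          ((1 + q : ℝ) : ℂ) ^ (-((σ : ℂ) + u * Complex.I)) := by
      rw [div_eq_mul_inv, Complex.ofReal_mul,
        Complex.mul_cpow_ofReal_nonneg hp.le (by positivity), Complex.ofReal_inv,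
        Complex.inv_cpow _ _ (by
          rw [Complex.arg_ofReal_of_nonneg (by positivity)]; positivity), Complex.cpow_neg]
    rw [h']
    trans (Complex.Gamma (1 - (σ + u * Complex.I)) / (σ + u * Complex.I) *
      (p : ℂ) ^ ((σ : ℂ) + u * Complex.I)) * (2 * Real.pi * Complex.Gamma (σ + u * Complex.I) *
        ((1 + q : ℝ) : ℂ) ^ (-((σ : ℂ) + u * Complex.I)))
    · rw [← h, ← integral_const_mul]
      refine integral_congr_ae (.of_forall fun v => ?_)
      simp only [capacityKernel]; ring
    · ring
  simp_rw [hin]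
  rw [integral_const_mul, integral_Gamma_mul_cpow_eq_log hσ hσ1 hpq]
  ring

/-! ### The generalized Gamma distribution -/

/-- The density of the generalized Gamma distribution on the positive half-line. -/
def ggPDF (a b c x : ℝ) : ℝ :=
  c * x ^ (a * c - 1) / (b ^ (a * c) * Real.Gamma a) * Real.exp (-((x / b) ^ c))

/-- The generalized Gamma distribution. -/
def ggMeasure (a b c : ℝ) : Measure ℝ :=
  (volume.restrict (Set.Ioi 0)).withDensity fun x => ENNReal.ofReal (ggPDF a b c x)

instance (a b c : ℝ) : SFinite (ggMeasure a b c) := by unfold ggMeasure; infer_instance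

lemma measurable_ggPDF (a b c : ℝ) : Measurable (ggPDF a b c) := by
  unfold ggPDF; fun_prop

lemma ggPDF_nonneg {a b c x : ℝ} (ha : 0 < a) (hb : 0 < b) (hc : 0 < c) (hx : 0 < x) :
    0 ≤ ggPDF a b c x := by
  have := Real.Gamma_pos_of_pos ha
  unfold ggPDF; positivity

lemma ae_ggMeasure_pos (a b c : ℝ) : ∀ᵐ x ∂ggMeasure a b c, 0 < x :=
  (withDensity_absolutelyContinuous _ _).ae_le (ae_restrict_mem measurableSet_Ioi)

lemma eggMeasure_eq_add {ω lam a b c : ℝ} (hω : 0 < ω ∧ ω < 1) (hlam : 0 < lam) (ha : 0 < a)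
    (hb : 0 < b) (hc : 0 < c) :
    eggMeasure ω lam a b c = ENNReal.ofReal ω • ggMeasure 1 lam 1 +
      ENNReal.ofReal (1 - ω) • ggMeasure a b c := by
  have hm := fun a b c => (measurable_ggPDF a b c).ennreal_ofReal
  rw [ggMeasure, ggMeasure, ← withDensity_smul _ (hm _ _ _), ← withDensity_smul _ (hm _ _ _),
    ← withDensity_add_left ((hm _ _ _).const_smul _), ← withDensity_indicator measurableSet_Ioi,
    eggMeasure]
  congr 1
  funext x
  by_cases hx : 0 < x
  · rw [Set.indicator_of_mem (show x ∈ Set.Ioi 0 from hx)]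
    have h1 := ggPDF_nonneg one_pos hlam one_pos hx
    have h2 := ggPDF_nonneg ha hb hc hx
    have h3 : 0 ≤ 1 - ω := by linarith [hω.2]
    simp only [Pi.add_apply, Pi.smul_apply, smul_eq_mul]
    rw [← ENNReal.ofReal_mul hω.1.le, ← ENNReal.ofReal_mul h3,
      ← ENNReal.ofReal_add (mul_nonneg hω.1.le h1) (mul_nonneg h3 h2)]
    congr 1
    simp only [eggPDF, if_pos hx, ggPDF]
    simp
    ring
  · rw [Set.indicator_of_notMem (show x ∉ Set.Ioi 0 from hx), eggPDF, if_neg hx]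
    simp

/-- The substitution `x = b u ^ (1 / c)` reduces this to the Gamma integral at `w / c`. -/
lemma mellin_exp_neg_div_rpow {b c : ℝ} (hb : 0 < b) (hc : 0 < c) {w : ℂ} (hw : 0 < w.re) :
    HasMellin (fun x : ℝ => ((Real.exp (-((x / b) ^ c)) : ℝ) : ℂ)) w
      ((b : ℂ) ^ w * ((c : ℂ)⁻¹ * Complex.Gamma (w / c))) := by
  set f : ℝ → ℂ := fun x => ((Real.exp (-x) : ℝ) : ℂ) with hf
  have hwc : 0 < (w / c).re := by
    rw [Complex.div_ofReal_re]; positivity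
  have hfc : MellinConvergent f (w / c) := by
    refine (Complex.GammaIntegral_convergent hwc).congr_fun (fun x _ => ?_) measurableSet_Ioi
    simp [hf, mul_comm]
  have hfm : mellin f (w / c) = Complex.Gamma (w / c) := by
    rw [Complex.Gamma_eq_integral hwc, Complex.GammaIntegral_eq_mellin]
  have e : (fun x : ℝ => ((Real.exp (-((x / b) ^ c)) : ℝ) : ℂ)) =
      fun x => (fun u => f (u ^ c)) (b⁻¹ * x) := by
    funext x
    simp only [hf, div_eq_inv_mul]
  rw [e]
  refine ⟨(MellinConvergent.comp_mul_left (inv_pos.2 hb)).2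
    ((MellinConvergent.comp_rpow hc.ne').2 hfc), ?_⟩
  rw [mellin_comp_mul_left (fun u => f (u ^ c)) _ (inv_pos.2 hb), mellin_comp_rpow, hfm,
    abs_of_pos hc, Complex.ofReal_inv, Complex.inv_cpow _ _ (by
      rw [Complex.arg_ofReal_of_nonneg hb.le]; positivity), ← Complex.cpow_neg, neg_neg,
    smul_eq_mul, Complex.real_smul, Complex.ofReal_inv]

lemma ggPDF_smul_cpow {a b c x : ℝ} (hx : 0 < x) (z : ℂ) :
    ggPDF a b c x • (x : ℂ) ^ z = ((c / (b ^ (a * c) * Real.Gamma a) : ℝ) : ℂ) *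
      ((x : ℂ) ^ ((a * c + z) - 1) • ((Real.exp (-((x / b) ^ c)) : ℝ) : ℂ)) := by
  have hx' : (x : ℂ) ≠ 0 := Complex.ofReal_ne_zero.2 hx.ne'
  rw [show (a * c + z : ℂ) - 1 = ((a * c - 1 : ℝ) : ℂ) + z by push_cast; ring,
    Complex.cpow_add _ _ hx', ← Complex.ofReal_cpow hx.le, ggPDF, Complex.real_smul]
  push_cast
  simp only [smul_eq_mul]
  ring

lemma integrable_cpow_ggMeasure {a b c : ℝ} (ha : 0 < a) (hb : 0 < b) (hc : 0 < c) {z : ℂ}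
    (hz : 0 < a * c + z.re) : Integrable (fun x : ℝ => (x : ℂ) ^ z) (ggMeasure a b c) := by
  rw [ggMeasure, integrable_withDensity_iff_integrable_smul'
    (measurable_ggPDF a b c).ennreal_ofReal (by simp)]
  have h := (mellin_exp_neg_div_rpow hb hc (w := a * c + z) (by simpa using hz)).1
  refine IntegrableOn.congr_fun (h.const_mul ((c / (b ^ (a * c) * Real.Gamma a) : ℝ) : ℂ))
    (fun x hx => ?_) measurableSet_Ioi
  simp only
  rw [ENNReal.toReal_ofReal (ggPDF_nonneg ha hb hc hx), ggPDF_smul_cpow hx]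

/-- The moment is the normalizing constant times the Mellin transform at `a c + z`; the factors `c`
and `b ^ (a c)` cancel. -/
lemma integral_cpow_ggMeasure {a b c : ℝ} (ha : 0 < a) (hb : 0 < b) (hc : 0 < c) {z : ℂ}
    (hz : 0 < a * c + z.re) : ∫ x : ℝ, (x : ℂ) ^ z ∂ggMeasure a b c =
      (b : ℂ) ^ z * (Complex.Gamma (a + z / c) / Real.Gamma a) := by
  have hb' : (b : ℂ) ≠ 0 := Complex.ofReal_ne_zero.2 hb.ne'
  have hc' : (c : ℂ) ≠ 0 := Complex.ofReal_ne_zero.2 hc.ne'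
  have h := (mellin_exp_neg_div_rpow hb hc (w := a * c + z) (by simpa using hz)).2
  rw [ggMeasure, integral_withDensity_eq_integral_toReal_smul
    (measurable_ggPDF a b c).ennreal_ofReal (by simp)]
  rw [setIntegral_congr_fun (g := fun x : ℝ => ((c / (b ^ (a * c) * Real.Gamma a) : ℝ) : ℂ) *
      ((x : ℂ) ^ ((a * c + z) - 1) • ((Real.exp (-((x / b) ^ c)) : ℝ) : ℂ))) measurableSet_Ioi
    fun x hx => by
      simp only
      rw [ENNReal.toReal_ofReal (ggPDF_nonneg ha hb hc hx), ggPDF_smul_cpow hx]]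
  rw [integral_const_mul]
  rw [mellin] at h
  rw [h, Complex.cpow_add _ _ hb', show (a * c + z : ℂ) / c = a + z / c by field_simp]
  have hG : (Real.Gamma a : ℂ) ≠ 0 := Complex.ofReal_ne_zero.2 (Real.Gamma_pos_of_pos ha).ne'
  have hba : (b : ℂ) ^ ((a : ℂ) * c) ≠ 0 := by simp [Complex.cpow_eq_zero_iff, hb']
  push_cast
  rw [Complex.ofReal_cpow hb.le, Complex.ofReal_mul]
  generalize (b : ℂ) ^ ((a : ℂ) * c) = B at hba
  field_simp

lemma integrable_pow_ggMeasure {a b c : ℝ} (ha : 0 < a) (hb : 0 < b) (hc : 0 < c) (r : ℕ) :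
    Integrable (fun x : ℝ => x ^ r) (ggMeasure a b c) := by
  have := (integrable_cpow_ggMeasure ha hb hc (z := r) (by simp; positivity)).re
  refine this.congr (.of_forall fun x => ?_)
  simp [← Complex.ofReal_pow]

lemma integral_pow_ggMeasure {a b c : ℝ} (ha : 0 < a) (hb : 0 < b) (hc : 0 < c) (r : ℕ) :
    ∫ x, x ^ r ∂ggMeasure a b c = b ^ r * (Real.Gamma (a + r / c) / Real.Gamma a) := by
  have h := integral_cpow_ggMeasure ha hb hc (z := r) (by simp; positivity)
  simp only [Complex.cpow_natCast, ← Complex.ofReal_pow] at h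
  rw [integral_complex_ofReal] at h
  have e : (a + r / c : ℂ) = ((a + r / c : ℝ) : ℂ) := by push_cast; rfl
  rw [e, Complex.Gamma_ofReal] at h
  exact_mod_cast h

/-! ### The Fox H function of two variables -/

section Bivariate

variable {n₁ p₁ q₁ m₂ n₂ p₂ q₂ m₃ n₃ p₃ q₃ : ℕ} {J : FoxHJointBlock n₁ p₁ q₁}
  {A : FoxHBlock m₂ n₂ p₂ q₂} {B : FoxHBlock m₃ n₃ p₃ q₃} {x y : ℝ} {h : ℂ}

/-- Values are unique because a separating pair of lines exists, and both candidates equal the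
integral along it. -/
lemma IsBivariateFoxH.bivariateFoxH_eq (hh : IsBivariateFoxH J A B x y h) :
    bivariateFoxH J A B x y = h := by
  have hc : BivariateFoxHConverges J A B x y := ⟨h, hh⟩
  obtain ⟨σ, κ, h1, h2, h3⟩ := hh.1
  rw [bivariateFoxH, dif_pos hc, ← (hh.2 σ κ h1 h2 h3).2,
    (hc.choose_spec.2 σ κ h1 h2 h3).2]

lemma IsBivariateFoxH.congr_left {A' : FoxHBlock m₂ n₂ p₂ q₂}
    (hh : IsBivariateFoxH J A B x y h) (hk : ∀ s, A'.kernel s = A.kernel s)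
    (hs : ∀ σ, A'.Separates σ ↔ A.Separates σ) : IsBivariateFoxH J A' B x y h := by
  have hf : foxHIntegrand J A' B x y = foxHIntegrand J A B x y := by
    funext σ κ z
    simp only [foxHIntegrand, hk]
  simpa only [IsBivariateFoxH, hf, hs] using hh

end Bivariate

lemma capacitySecondExp_eq (r : ℕ) : capacitySecondExp r = capacitySecondGG 1 1 r := by
  simp [capacitySecondExp, capacitySecondGG]

/-- The two upper parameter lists differ only by a transposition, so the blocks are not equal but
their kernels are. -/
lemma capacityFirstExp_kernel (r : ℕ) (s : ℂ) :
    (capacityFirstExp r).kernel s = (capacityFirstGG 1 1 r).kernel s := by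
  simp [FoxHBlock.kernel, capacityFirstExp, capacityFirstGG, Fin.prod_univ_two, mul_comm]

lemma capacityFirstExp_separates (r : ℕ) (σ : ℝ) :
    (capacityFirstExp r).Separates σ ↔ (capacityFirstGG 1 1 r).Separates σ := by
  simp [FoxHBlock.Separates, capacityFirstExp, capacityFirstGG, Fin.forall_fin_two, and_comm]

lemma capacityJoint_separates {σ κ : ℝ} : capacityJoint.Separates σ κ ↔ 0 < σ + κ := by
  simp [FoxHJointBlock.Separates, capacityJoint]

lemma capacityFirstGG_separates {a c σ : ℝ} (ha : 0 < a) (hc : 0 < c) (r : ℕ) :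
    (capacityFirstGG a c r).Separates σ ↔ 0 < σ ∧ σ < 1 := by
  simp only [FoxHBlock.Separates, capacityFirstGG, Fin.forall_fin_two]
  simp
  constructor
  · rintro ⟨h1, h2, -⟩; exact ⟨h2, h1⟩
  · rintro ⟨h1, h2⟩; exact ⟨h2, h1, by positivity⟩

lemma capacitySecondGG_separates {a c κ : ℝ} (ha : 0 < a) (hc : 0 < c) (r : ℕ) :
    (capacitySecondGG a c r).Separates κ ↔ κ < 0 := by
  simp only [FoxHBlock.Separates, capacitySecondGG, Fin.forall_fin_two]
  simp
  intro h
  have : (r : ℝ) / c * κ ≤ 0 := mul_nonpos_of_nonneg_of_nonpos (by positivity) h.le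
  linarith

/-- Since `Γ(1 + s) = s Γ(s)`, the factor coming from `(1, 1)` cancels against the denominator and
leaves `1 / s`. -/
lemma capacityGG_kernel {a₁ c₁ a₂ c₂ : ℝ} (r₁ r₂ : ℕ) {s : ℂ} (hs : 0 < s.re) (t : ℂ) :
    capacityJoint.kernel s t * (capacityFirstGG a₁ c₁ r₁).kernel s *
      (capacitySecondGG a₂ c₂ r₂).kernel t =
    capacityKernel s t * Complex.Gamma (a₁ + r₁ * s / c₁) * Complex.Gamma (a₂ + -(r₂ * t) / c₂) := by
  have h0 : s ≠ 0 := by rintro rfl; simp at hs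
  have hG : Complex.Gamma s ≠ 0 := Complex.Gamma_ne_zero_of_re_pos hs
  simp [FoxHJointBlock.kernel, FoxHBlock.kernel, capacityJoint, capacityFirstGG, capacitySecondGG,
    Fin.prod_univ_two, capacityKernel]
  rw [add_comm 1 s, Complex.Gamma_add_one s h0,
    show (r₁ : ℂ) / c₁ * s = r₁ * s / c₁ by ring,
    show (a₂ : ℂ) - r₂ / c₂ * t = a₂ + -(r₂ * t) / c₂ by ring]
  field_simp

/-! ### Averaging the Mellin–Barnes representation of the logarithm -/

lemma ofReal_pow_cpow {w : ℝ} (hw : 0 < w) (r : ℕ) (s : ℂ) :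
    ((w ^ r : ℝ) : ℂ) ^ s = (w : ℂ) ^ (r * s) := by
  rw [Complex.cpow_def_of_ne_zero (Complex.ofReal_ne_zero.2 (pow_pos hw r).ne'),
    Complex.cpow_def_of_ne_zero (Complex.ofReal_ne_zero.2 hw.ne'),
    ← Complex.ofReal_log (pow_pos hw r).le, ← Complex.ofReal_log hw.le, Real.log_pow]
  push_cast
  ring_nf

lemma ofReal_mul_pow_cpow {x w : ℝ} (hx : 0 < x) (hw : 0 < w) (r : ℕ) (s : ℂ) :
    ((x * w ^ r : ℝ) : ℂ) ^ s = (x : ℂ) ^ s * (w : ℂ) ^ (r * s) := by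
  rw [Complex.ofReal_mul, Complex.mul_cpow_ofReal_nonneg hx.le (pow_pos hw r).le,
    ofReal_pow_cpow hw]

lemma ofReal_div_pow_cpow {y w : ℝ} (hy : 0 < y) (hw : 0 < w) (r : ℕ) (t : ℂ) :
    ((y / w ^ r : ℝ) : ℂ) ^ t = (y : ℂ) ^ t * (w : ℂ) ^ (-(r * t)) := by
  rw [div_eq_mul_inv, Complex.ofReal_mul, Complex.mul_cpow_ofReal_nonneg hy.le (by positivity),
    Complex.ofReal_inv, Complex.inv_cpow _ _ (by
      rw [Complex.arg_ofReal_of_nonneg (by positivity)]; positivity), ofReal_pow_cpow hw,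
    Complex.cpow_neg]

/-- The logarithm of `1` plus a scaled end-to-end SNR, as a function of the two irradiances. -/
def capacityLog (x y : ℝ) (r₁ r₂ : ℕ) (w : ℝ × ℝ) : ℝ :=
  Real.log (1 + x * w.1 ^ r₁ / (1 + y / w.2 ^ r₂))

/-- The Mellin–Barnes integrand of `capacityLog`. -/
def capacityLogIntegrand (x y σ κ : ℝ) (r₁ r₂ : ℕ) (w z : ℝ × ℝ) : ℂ :=
  capacityKernel (σ + z.1 * Complex.I) (κ + z.2 * Complex.I) *
    (((x * w.1 ^ r₁ : ℝ) : ℂ) ^ ((σ : ℂ) + z.1 * Complex.I) *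
      ((y / w.2 ^ r₂ : ℝ) : ℂ) ^ ((κ : ℂ) + z.2 * Complex.I))

section Averaging

variable {ν₁ ν₂ : Measure ℝ} {x y σ κ : ℝ} {r₁ r₂ : ℕ}

lemma ae_prod_pos (h₁ : ∀ᵐ w ∂ν₁, 0 < w) (h₂ : ∀ᵐ w ∂ν₂, 0 < w) :
    ∀ᵐ w ∂ν₁.prod ν₂, 0 < w.1 ∧ 0 < w.2 :=
  (Measure.quasiMeasurePreserving_fst.ae h₁).and (Measure.quasiMeasurePreserving_snd.ae h₂)

lemma measurable_capacityKernel (hσ1 : σ < 1) (hκ : κ < 0) (hσκ : 0 < σ + κ) :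
    Measurable fun z : ℝ × ℝ =>
      capacityKernel (σ + z.1 * Complex.I) (κ + z.2 * Complex.I) := by
  unfold capacityKernel
  refine ((Continuous.Gamma_of_re_pos ?_ ?_).measurable.mul
    ((Continuous.Gamma_of_re_pos ?_ ?_).measurable.div ?_)).mul
    (Continuous.Gamma_of_re_pos ?_ ?_).measurable
  all_goals first | fun_prop | (intro z; simp; linarith)

lemma integrable_capacityLogIntegrand (hσ : 0 < σ) (hσ1 : σ < 1) (hκ : κ < 0)
    (hσκ : 0 < σ + κ) (hx : 0 < x) (hy : 0 < y)
    (h₁ : ∀ᵐ w ∂ν₁, 0 < w) (h₂ : ∀ᵐ w ∂ν₂, 0 < w)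
    (hi₁ : Integrable (fun w : ℝ => (w : ℂ) ^ ((r₁ : ℂ) * σ)) ν₁)
    (hi₂ : Integrable (fun w : ℝ => (w : ℂ) ^ (-((r₂ : ℂ) * κ))) ν₂) :
    Integrable (Function.uncurry (capacityLogIntegrand x y σ κ r₁ r₂))
      ((ν₁.prod ν₂).prod volume) := by
  have hb := (hi₁.norm.mul_prod hi₂.norm).mul_prod
    ((integrable_capacityKernel hσ hσ1 hκ hσκ).norm.mul_const (x ^ σ * y ^ κ))
  refine Integrable.mono' hb ?_ ?_
  · refine Measurable.aestronglyMeasurable ?_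
    simp only [Function.uncurry_def, capacityLogIntegrand]
    exact ((measurable_capacityKernel hσ1 hκ hσκ).comp measurable_snd).mul (by fun_prop)
  · filter_upwards [Measure.quasiMeasurePreserving_fst.ae (ae_prod_pos h₁ h₂)] with v hv
    simp only [Function.uncurry_def, capacityLogIntegrand]
    rw [ofReal_mul_pow_cpow hx hv.1, ofReal_div_pow_cpow hy hv.2]
    simp only [norm_mul, Complex.norm_cpow_eq_rpow_re_of_pos hx,
      Complex.norm_cpow_eq_rpow_re_of_pos hy, Complex.norm_cpow_eq_rpow_re_of_pos hv.1,
      Complex.norm_cpow_eq_rpow_re_of_pos hv.2]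
    simp
    apply le_of_eq
    ring

lemma integral_capacityLogIntegrand (hσ : 0 < σ) (hσ1 : σ < 1) (hκ : κ < 0)
    (hσκ : 0 < σ + κ) (hx : 0 < x) (hy : 0 < y) {w : ℝ × ℝ} (hw : 0 < w.1 ∧ 0 < w.2) :
    ∫ z, capacityLogIntegrand x y σ κ r₁ r₂ w z =
      (2 * Real.pi) ^ 2 * (capacityLog x y r₁ r₂ w : ℝ) :=
  integral_capacityKernel_mul_cpow hσ hσ1 hκ hσκ (mul_pos hx (pow_pos hw.1 _))
    (div_pos hy (pow_pos hw.2 _))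

/-- At fixed `s` and `t` the integrand is a product of a function of each irradiance, so only the
two separate moments remain. -/
lemma integral_capacityLogIntegrand_prod [SFinite ν₁] [SFinite ν₂] (hx : 0 < x) (hy : 0 < y)
    (h₁ : ∀ᵐ w ∂ν₁, 0 < w) (h₂ : ∀ᵐ w ∂ν₂, 0 < w) (z : ℝ × ℝ) :
    ∫ w, capacityLogIntegrand x y σ κ r₁ r₂ w z ∂ν₁.prod ν₂ =
      capacityKernel (σ + z.1 * Complex.I) (κ + z.2 * Complex.I) *
        ((x : ℂ) ^ ((σ : ℂ) + z.1 * Complex.I) * (y : ℂ) ^ ((κ : ℂ) + z.2 * Complex.I)) *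
        ((∫ w : ℝ, (w : ℂ) ^ (r₁ * ((σ : ℂ) + z.1 * Complex.I)) ∂ν₁) *
          ∫ w : ℝ, (w : ℂ) ^ (-(r₂ * ((κ : ℂ) + z.2 * Complex.I))) ∂ν₂) := by
  rw [← integral_prod_mul, ← integral_const_mul]
  refine integral_congr_ae ?_
  filter_upwards [ae_prod_pos h₁ h₂] with w hw
  simp only [capacityLogIntegrand]
  rw [ofReal_mul_pow_cpow hx hw.1, ofReal_div_pow_cpow hy hw.2]
  ring

/-- This is a by-product of Fubini: up to `(2 π) ^ 2` the logarithm is the inner integral of a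
jointly integrable function. -/
lemma integrable_capacityLog (hσ : 0 < σ) (hσ1 : σ < 1) (hκ : κ < 0)
    (hσκ : 0 < σ + κ) (hx : 0 < x) (hy : 0 < y)
    (h₁ : ∀ᵐ w ∂ν₁, 0 < w) (h₂ : ∀ᵐ w ∂ν₂, 0 < w)
    (hi₁ : Integrable (fun w : ℝ => (w : ℂ) ^ ((r₁ : ℂ) * σ)) ν₁)
    (hi₂ : Integrable (fun w : ℝ => (w : ℂ) ^ (-((r₂ : ℂ) * κ))) ν₂) :
    Integrable (capacityLog x y r₁ r₂) (ν₁.prod ν₂) := by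
  have h := (integrable_capacityLogIntegrand hσ hσ1 hκ hσκ hx hy h₁ h₂ hi₁ hi₂).integral_prod_left
  refine (h.re.const_mul (((2 * Real.pi) ^ 2)⁻¹)).congr ?_
  filter_upwards [ae_prod_pos h₁ h₂] with w hw
  have := integral_capacityLogIntegrand (r₁ := r₁) (r₂ := r₂) hσ hσ1 hκ hσκ hx hy hw
  simp only [Function.uncurry_def]
  rw [this, show ((2 * Real.pi) ^ 2 * (capacityLog x y r₁ r₂ w : ℝ) : ℂ) =
    (((2 * Real.pi) ^ 2 * capacityLog x y r₁ r₂ w : ℝ) : ℂ) by push_cast; ring]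
  simp only [RCLike.re_to_complex, Complex.ofReal_re]
  rw [← mul_assoc, inv_mul_cancel₀ (by positivity), one_mul]

end Averaging

section GeneralizedGamma

variable {a₁ b₁ c₁ a₂ b₂ c₂ x y : ℝ}

lemma capacity_moments_integrable (ha₁ : 0 < a₁) (hb₁ : 0 < b₁) (hc₁ : 0 < c₁) (ha₂ : 0 < a₂)
    (hb₂ : 0 < b₂) (hc₂ : 0 < c₂) {σ κ : ℝ} (hσ : 0 < σ) (hκ : κ < 0) (r₁ r₂ : ℕ) :
    Integrable (fun w : ℝ => (w : ℂ) ^ ((r₁ : ℂ) * σ)) (ggMeasure a₁ b₁ c₁) ∧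
      Integrable (fun w : ℝ => (w : ℂ) ^ (-((r₂ : ℂ) * κ))) (ggMeasure a₂ b₂ c₂) := by
  constructor
  · refine integrable_cpow_ggMeasure ha₁ hb₁ hc₁ ?_
    simp; positivity
  · refine integrable_cpow_ggMeasure ha₂ hb₂ hc₂ ?_
    have : (r₂ : ℝ) * κ ≤ 0 := mul_nonpos_of_nonneg_of_nonpos (by positivity) hκ.le
    simp; nlinarith [mul_pos ha₂ hc₂]

lemma integrable_capacityLog_ggMeasure (ha₁ : 0 < a₁) (hb₁ : 0 < b₁) (hc₁ : 0 < c₁)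
    (ha₂ : 0 < a₂) (hb₂ : 0 < b₂) (hc₂ : 0 < c₂) (hx : 0 < x) (hy : 0 < y) (r₁ r₂ : ℕ) :
    Integrable (capacityLog x y r₁ r₂) ((ggMeasure a₁ b₁ c₁).prod (ggMeasure a₂ b₂ c₂)) := by
  obtain ⟨h1, h2⟩ := capacity_moments_integrable ha₁ hb₁ hc₁ ha₂ hb₂ hc₂ (σ := 1 / 2)
    (κ := -(1 / 4)) (by norm_num) (by norm_num) r₁ r₂
  exact integrable_capacityLog (by norm_num) (by norm_num) (by norm_num) (by norm_num) hx hy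
    (ae_ggMeasure_pos _ _ _) (ae_ggMeasure_pos _ _ _) h1 h2

/-- The ergodic capacity of a link with generalized Gamma fading is a bivariate Fox H function. -/
theorem isBivariateFoxH_capacityGG (ha₁ : 0 < a₁) (hb₁ : 0 < b₁) (hc₁ : 0 < c₁) (ha₂ : 0 < a₂)
    (hb₂ : 0 < b₂) (hc₂ : 0 < c₂) (hx : 0 < x) (hy : 0 < y) (r₁ r₂ : ℕ) :
    IsBivariateFoxH capacityJoint (capacityFirstGG a₁ c₁ r₁) (capacitySecondGG a₂ c₂ r₂)
      (x * b₁ ^ r₁) (y / b₂ ^ r₂)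
      (Real.Gamma a₁ * Real.Gamma a₂ *
        (∫ w, capacityLog x y r₁ r₂ w ∂(ggMeasure a₁ b₁ c₁).prod (ggMeasure a₂ b₂ c₂) : ℝ)) := by
  have hG₁ : (Real.Gamma a₁ : ℂ) ≠ 0 := Complex.ofReal_ne_zero.2 (Real.Gamma_pos_of_pos ha₁).ne'
  have hG₂ : (Real.Gamma a₂ : ℂ) ≠ 0 := Complex.ofReal_ne_zero.2 (Real.Gamma_pos_of_pos ha₂).ne'
  simp only [IsBivariateFoxH, capacityJoint_separates, capacityFirstGG_separates ha₁ hc₁,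
    capacitySecondGG_separates ha₂ hc₂]
  refine ⟨⟨1 / 2, -(1 / 4), by norm_num⟩, fun σ κ hσκ ⟨hσ, hσ1⟩ hκ => ?_⟩
  obtain ⟨hm₁, hm₂⟩ := capacity_moments_integrable ha₁ hb₁ hc₁ ha₂ hb₂ hc₂ hσ hκ r₁ r₂
  have hp₁ := ae_ggMeasure_pos a₁ b₁ c₁
  have hp₂ := ae_ggMeasure_pos a₂ b₂ c₂
  have hint := integrable_capacityLogIntegrand hσ hσ1 hκ hσκ hx hy hp₁ hp₂ hm₁ hm₂
  -- Pointwise on the contours, the Fox H integrand is the averaged Mellin–Barnes integrand; `Γ(a₁)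
  -- Γ(a₂)` undoes the normalization of the moments.
  have key : foxHIntegrand capacityJoint (capacityFirstGG a₁ c₁ r₁) (capacitySecondGG a₂ c₂ r₂)
      (x * b₁ ^ r₁) (y / b₂ ^ r₂) σ κ = fun z => Real.Gamma a₁ * Real.Gamma a₂ *
        ∫ w, capacityLogIntegrand x y σ κ r₁ r₂ w z
          ∂(ggMeasure a₁ b₁ c₁).prod (ggMeasure a₂ b₂ c₂) := by
    funext z
    have e₁ : 0 < a₁ * c₁ + ((r₁ : ℂ) * (σ + z.1 * Complex.I)).re := by
      simp; positivity
    have e₂ : 0 < a₂ * c₂ + (-((r₂ : ℂ) * (κ + z.2 * Complex.I))).re := by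
      have : (r₂ : ℝ) * κ ≤ 0 := mul_nonpos_of_nonneg_of_nonpos (by positivity) hκ.le
      simp; nlinarith [mul_pos ha₂ hc₂]
    rw [integral_capacityLogIntegrand_prod hx hy hp₁ hp₂,
      integral_cpow_ggMeasure ha₁ hb₁ hc₁ e₁, integral_cpow_ggMeasure ha₂ hb₂ hc₂ e₂,
      foxHIntegrand, capacityGG_kernel r₁ r₂ (by simpa using hσ), ofReal_mul_pow_cpow hx hb₁,
      ofReal_div_pow_cpow hy hb₂]
    field_simp
  rw [key]
  refine ⟨hint.integral_prod_right.const_mul _, ?_⟩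
  -- Contour integration comes first after the swap and restores the logarithm; its factor `(2 π) ^
  -- 2` cancels `i ^ 2 / (2 π i) ^ 2`.
  rw [integral_const_mul, ← integral_integral_swap hint, integral_congr_ae
    (g := fun w => (2 * Real.pi) ^ 2 * ((capacityLog x y r₁ r₂ w : ℝ) : ℂ)) (by
      filter_upwards [ae_prod_pos hp₁ hp₂] with w hw
      exact integral_capacityLogIntegrand hσ hσ1 hκ hσκ hx hy hw),
    integral_const_mul, integral_complex_ofReal]
  have hpi : (Real.pi : ℂ) ≠ 0 := Complex.ofReal_ne_zero.2 Real.pi_ne_zero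
  have hI : Complex.I ≠ 0 := Complex.I_ne_zero
  field_simp

end GeneralizedGamma

/-! ### The mixture Exponential-Generalized Gamma channel -/

lemma integral_pow_eggMeasure {ω lam a b c : ℝ} (hω : 0 < ω ∧ ω < 1) (hlam : 0 < lam)
    (ha : 0 < a) (hb : 0 < b) (hc : 0 < c) (r : ℕ) :
    ∫ w, w ^ r ∂eggMeasure ω lam a b c = ω * lam ^ r * Real.Gamma (1 + r) +
      (1 - ω) * b ^ r * (Real.Gamma (a + r / c) / Real.Gamma a) := by
  rw [eggMeasure_eq_add hω hlam ha hb hc, integral_add_measure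
    ((integrable_pow_ggMeasure one_pos hlam one_pos r).smul_measure ENNReal.ofReal_ne_top)
    ((integrable_pow_ggMeasure ha hb hc r).smul_measure ENNReal.ofReal_ne_top),
    integral_smul_measure, integral_smul_measure, integral_pow_ggMeasure one_pos hlam one_pos,
    integral_pow_ggMeasure ha hb hc, ENNReal.toReal_ofReal hω.1.le,
    ENNReal.toReal_ofReal (by linarith [hω.2])]
  simp
  ring

/-- The mean SNR is `η ^ r / N₀` times the `r`-th moment of the irradiance, which is precisely the
positive divisor. -/
lemma averageElectricalSNR_hopSNR {Ω : Type*} [MeasurableSpace Ω] {P : Measure Ω}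
    {ω lam a b c η N₀ : ℝ} (hω : 0 < ω ∧ ω < 1) (hlam : 0 < lam)
    (ha : 0 < a) (hb : 0 < b) (hc : 0 < c) (r : ℕ) {I : Ω → ℝ}
    (hI : HasLaw I (eggMeasure ω lam a b c) P) :
    averageElectricalSNR ω lam a b c r (∫ x, hopSNR η N₀ r (I x) ∂P) = η ^ r / N₀ := by
  have h : ∫ x, hopSNR η N₀ r (I x) ∂P = η ^ r / N₀ * ∫ w, w ^ r ∂eggMeasure ω lam a b c := by
    rw [← hI.integral_comp (f := fun w => w ^ r) (by fun_prop), ← integral_const_mul]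
    refine integral_congr_ae (.of_forall fun x => ?_)
    simp only [hopSNR, Function.comp_apply]
    ring
  rw [h, integral_pow_eggMeasure hω hlam ha hb hc, averageElectricalSNR]
  refine mul_div_cancel_right₀ _ (ne_of_gt ?_)
  have h1 := hω.1
  have h2 : 0 < 1 - ω := by linarith [hω.2]
  have h3 := Real.Gamma_pos_of_pos ha
  have h4 : 0 < Real.Gamma (1 + r) := Real.Gamma_pos_of_pos (by positivity)
  have h5 : 0 < Real.Gamma (a + r / c) := Real.Gamma_pos_of_pos (by positivity)
  positivity

lemma ae_eggMeasure_pos {ω lam a b c : ℝ} (hω : 0 < ω ∧ ω < 1) (hlam : 0 < lam) (ha : 0 < a)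
    (hb : 0 < b) (hc : 0 < c) : ∀ᵐ x ∂eggMeasure ω lam a b c, 0 < x := by
  rw [eggMeasure_eq_add hω hlam ha hb hc, ae_add_measure_iff]
  exact ⟨Measure.ae_smul_measure (ae_ggMeasure_pos _ _ _) _,
    Measure.ae_smul_measure (ae_ggMeasure_pos _ _ _) _⟩

lemma prod_mixture {α β : Type*} [MeasurableSpace α] [MeasurableSpace β]
    {ν₁ ν₁' : Measure α} {ν₂ ν₂' : Measure β} [SFinite ν₁] [SFinite ν₁'] [SFinite ν₂] [SFinite ν₂']
    (p p' q q' : ENNReal) :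
    (p • ν₁ + p' • ν₁').prod (q • ν₂ + q' • ν₂') =
      (p * q) • ν₁.prod ν₂ + (p * q') • ν₁.prod ν₂' + (p' * q) • ν₁'.prod ν₂ +
        (p' * q') • ν₁'.prod ν₂' := by
  simp only [Measure.prod_add, Measure.add_prod, Measure.prod_smul_left, Measure.prod_smul_right,
    smul_add, smul_smul]
  rw [mul_comm q p, mul_comm q' p, mul_comm q p', mul_comm q' p']
  abel

lemma log_endToEndSNR {C τ k₁ k₂ w₁ w₂ : ℝ} (r₁ r₂ : ℕ) (hC : 0 < C) (hk₂ : 0 < k₂)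
    (hw₂ : 0 < w₂) :
    Real.log (1 + τ * endToEndSNR C (k₁ * w₁ ^ r₁) (k₂ * w₂ ^ r₂)) =
      capacityLog (τ * k₁) (C / k₂) r₁ r₂ (w₁, w₂) := by
  have h := pow_pos hw₂ r₂
  rw [capacityLog, endToEndSNR]
  congr 2
  have : k₂ * w₂ ^ r₂ + C ≠ 0 := by positivity
  field_simp

lemma integral_mixture {α β : Type*} [MeasurableSpace α] [MeasurableSpace β]
    {ν₁ ν₁' : Measure α} {ν₂ ν₂' : Measure β} [SFinite ν₁] [SFinite ν₁'] [SFinite ν₂] [SFinite ν₂']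
    {p q : ℝ} (hp : 0 < p ∧ p < 1) (hq : 0 < q ∧ q < 1) {f : α × β → ℝ}
    (h₁₁ : Integrable f (ν₁.prod ν₂)) (h₁₂ : Integrable f (ν₁.prod ν₂'))
    (h₂₁ : Integrable f (ν₁'.prod ν₂)) (h₂₂ : Integrable f (ν₁'.prod ν₂')) :
    Integrable f ((ENNReal.ofReal p • ν₁ + ENNReal.ofReal (1 - p) • ν₁').prod
      (ENNReal.ofReal q • ν₂ + ENNReal.ofReal (1 - q) • ν₂')) ∧
    ∫ w, f w ∂((ENNReal.ofReal p • ν₁ + ENNReal.ofReal (1 - p) • ν₁').prod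
      (ENNReal.ofReal q • ν₂ + ENNReal.ofReal (1 - q) • ν₂')) =
      p * q * ∫ w, f w ∂ν₁.prod ν₂ + p * (1 - q) * ∫ w, f w ∂ν₁.prod ν₂' +
        (1 - p) * q * ∫ w, f w ∂ν₁'.prod ν₂ + (1 - p) * (1 - q) * ∫ w, f w ∂ν₁'.prod ν₂' := by
  have hp' : 0 ≤ 1 - p := by linarith [hp.2]
  have hq' : 0 ≤ 1 - q := by linarith [hq.2]
  have ht : ∀ x y : ℝ, ENNReal.ofReal x * ENNReal.ofReal y ≠ ⊤ := fun x y =>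
    ENNReal.mul_ne_top ENNReal.ofReal_ne_top ENNReal.ofReal_ne_top
  have i₁₁ := h₁₁.smul_measure (ht p q)
  have i₁₂ := h₁₂.smul_measure (ht p (1 - q))
  have i₂₁ := h₂₁.smul_measure (ht (1 - p) q)
  have i₂₂ := h₂₂.smul_measure (ht (1 - p) (1 - q))
  rw [prod_mixture]
  refine ⟨((i₁₁.add_measure i₁₂).add_measure i₂₁).add_measure i₂₂, ?_⟩
  rw [integral_add_measure ((i₁₁.add_measure i₁₂).add_measure i₂₁) i₂₂,
    integral_add_measure (i₁₁.add_measure i₁₂) i₂₁, integral_add_measure i₁₁ i₁₂]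
  simp only [integral_smul_measure, ENNReal.toReal_mul, ENNReal.toReal_ofReal hp.1.le,
    ENNReal.toReal_ofReal hq.1.le, ENNReal.toReal_ofReal hp', ENNReal.toReal_ofReal hq',
    smul_eq_mul]

lemma measurable_capacityLog (x y : ℝ) (r₁ r₂ : ℕ) : Measurable (capacityLog x y r₁ r₂) := by
  unfold capacityLog; fun_prop

end

/-! ### The ergodic capacity formula -/

theorem theorem5
    {Ω : Type*} [MeasurableSpace Ω] (P : Measure Ω) [IsProbabilityMeasure P]
    -- parameters of the two EGG fading distributions
    (ω₁ lam₁ a₁ b₁ c₁ ω₂ lam₂ a₂ b₂ c₂ : ℝ)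
    (hω₁ : 0 < ω₁ ∧ ω₁ < 1) (hω₂ : 0 < ω₂ ∧ ω₂ < 1)
    (hlam₁ : 0 < lam₁) (ha₁ : 0 < a₁) (hb₁ : 0 < b₁) (hc₁ : 0 < c₁)
    (hlam₂ : 0 < lam₂) (ha₂ : 0 < a₂) (hb₂ : 0 < b₂) (hc₂ : 0 < c₂)
    -- the detection types (1 for heterodyne, 2 for IM/DD)
    (r₁ r₂ : ℕ) (hr₁ : r₁ = 1 ∨ r₁ = 2) (hr₂ : r₂ = 1 ∨ r₂ = 2)
    -- conversion ratio, noise powers, relay constant, capacity constant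
    (η N₁ N₂ C τ : ℝ) (hη : 0 < η) (hN₁ : 0 < N₁) (hN₂ : 0 < N₂) (hC : 0 < C) (hτ : 0 < τ)
    -- independent EGG irradiances
    (I₁ I₂ : Ω → ℝ)
    (hI₁ : HasLaw I₁ (eggMeasure ω₁ lam₁ a₁ b₁ c₁) P)
    (hI₂ : HasLaw I₂ (eggMeasure ω₂ lam₂ a₂ b₂ c₂) P)
    (hind : IndepFun I₁ I₂ P)
    -- the SNRs of the hops, their average electrical SNRs, and the end-to-end SNR
    (γ₁ γ₂ γ : Ω → ℝ)
    (hγ₁ : ∀ x, γ₁ x = hopSNR η N₁ r₁ (I₁ x)) (hγ₂ : ∀ x, γ₂ x = hopSNR η N₂ r₂ (I₂ x))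
    (hγ : ∀ x, γ x = endToEndSNR C (γ₁ x) (γ₂ x))
    (μ₁ μ₂ : ℝ)
    (hμ₁ : μ₁ = averageElectricalSNR ω₁ lam₁ a₁ b₁ c₁ r₁ (∫ x, γ₁ x ∂P))
    (hμ₂ : μ₂ = averageElectricalSNR ω₂ lam₂ a₂ b₂ c₂ r₂ (∫ x, γ₂ x ∂P)) :
    -- all the objects exist
    Integrable (fun x => Real.log (1 + τ * γ x)) P ∧
    BivariateFoxHConverges capacityJoint (capacityFirstExp r₁) (capacitySecondExp r₂)
      (τ * lam₁ ^ r₁ * μ₁) (C / (lam₂ ^ r₂ * μ₂)) ∧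
    BivariateFoxHConverges capacityJoint (capacityFirstExp r₁) (capacitySecondGG a₂ c₂ r₂)
      (τ * lam₁ ^ r₁ * μ₁) (C / (b₂ ^ r₂ * μ₂)) ∧
    BivariateFoxHConverges capacityJoint (capacityFirstGG a₁ c₁ r₁) (capacitySecondExp r₂)
      (τ * b₁ ^ r₁ * μ₁) (C / (lam₂ ^ r₂ * μ₂)) ∧
    BivariateFoxHConverges capacityJoint (capacityFirstGG a₁ c₁ r₁) (capacitySecondGG a₂ c₂ r₂)
      (τ * b₁ ^ r₁ * μ₁) (C / (b₂ ^ r₂ * μ₂)) ∧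
    -- the ergodic capacity
    ((∫ x, Real.log (1 + τ * γ x) ∂P : ℝ) : ℂ) =
      ω₁ * ω₂ *
        bivariateFoxH capacityJoint (capacityFirstExp r₁) (capacitySecondExp r₂)
          (τ * lam₁ ^ r₁ * μ₁) (C / (lam₂ ^ r₂ * μ₂))
      + ω₁ * (1 - ω₂) / Real.Gamma a₂ *
        bivariateFoxH capacityJoint (capacityFirstExp r₁) (capacitySecondGG a₂ c₂ r₂)
          (τ * lam₁ ^ r₁ * μ₁) (C / (b₂ ^ r₂ * μ₂))
      + ω₂ * (1 - ω₁) / Real.Gamma a₁ *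
        bivariateFoxH capacityJoint (capacityFirstGG a₁ c₁ r₁) (capacitySecondExp r₂)
          (τ * b₁ ^ r₁ * μ₁) (C / (lam₂ ^ r₂ * μ₂))
      + (1 - ω₁) * (1 - ω₂) / (Real.Gamma a₁ * Real.Gamma a₂) *
        bivariateFoxH capacityJoint (capacityFirstGG a₁ c₁ r₁) (capacitySecondGG a₂ c₂ r₂)
          (τ * b₁ ^ r₁ * μ₁) (C / (b₂ ^ r₂ * μ₂)) := by
  simp only [hγ₁] at hμ₁
  simp only [hγ₂] at hμ₂
  rw [averageElectricalSNR_hopSNR hω₁ hlam₁ ha₁ hb₁ hc₁ r₁ hI₁] at hμ₁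
  rw [averageElectricalSNR_hopSNR hω₂ hlam₂ ha₂ hb₂ hc₂ r₂ hI₂] at hμ₂
  have hμ₁0 : 0 < μ₁ := hμ₁ ▸ div_pos (pow_pos hη _) hN₁
  have hμ₂0 : 0 < μ₂ := hμ₂ ▸ div_pos (pow_pos hη _) hN₂
  have hx : 0 < τ * μ₁ := mul_pos hτ hμ₁0
  have hy : 0 < C / μ₂ := div_pos hC hμ₂0
  have hlaw : HasLaw (fun ω => (I₁ ω, I₂ ω))
      ((eggMeasure ω₁ lam₁ a₁ b₁ c₁).prod (eggMeasure ω₂ lam₂ a₂ b₂ c₂)) P :=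
    ⟨hI₁.aemeasurable.prodMk hI₂.aemeasurable, by
      rw [hind.map_prod_eq_prod_map_map hI₁.aemeasurable hI₂.aemeasurable, hI₁.map_eq, hI₂.map_eq]⟩
  have hpos : ∀ᵐ ω ∂P, 0 < I₂ ω := ae_of_ae_map hI₂.aemeasurable
    (hI₂.map_eq ▸ ae_eggMeasure_pos hω₂ hlam₂ ha₂ hb₂ hc₂)
  -- Only almost sure equality is available: rewriting the SNR with `C / γ₂` needs `I₂ > 0`.
  have hlog : (fun ω => capacityLog (τ * μ₁) (C / μ₂) r₁ r₂ (I₁ ω, I₂ ω)) =ᵐ[P]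
      fun ω => Real.log (1 + τ * γ ω) := by
    filter_upwards [hpos] with ω hω
    have e : ∀ N r I, hopSNR η N r I = η ^ r / N * I ^ r := fun N r I => by
      rw [hopSNR, mul_pow]; ring
    rw [hγ, hγ₁, hγ₂, e, e, ← hμ₁, ← hμ₂, log_endToEndSNR r₁ r₂ hC hμ₂0 hω]
  have hmeas := (measurable_capacityLog (τ * μ₁) (C / μ₂) r₁ r₂).aestronglyMeasurable
    (μ := (eggMeasure ω₁ lam₁ a₁ b₁ c₁).prod (eggMeasure ω₂ lam₂ a₂ b₂ c₂))
  obtain ⟨hmi, hme⟩ := integral_mixture hω₁ hω₂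
    (integrable_capacityLog_ggMeasure one_pos hlam₁ one_pos one_pos hlam₂ one_pos hx hy r₁ r₂)
    (integrable_capacityLog_ggMeasure one_pos hlam₁ one_pos ha₂ hb₂ hc₂ hx hy r₁ r₂)
    (integrable_capacityLog_ggMeasure ha₁ hb₁ hc₁ one_pos hlam₂ one_pos hx hy r₁ r₂)
    (integrable_capacityLog_ggMeasure ha₁ hb₁ hc₁ ha₂ hb₂ hc₂ hx hy r₁ r₂)
  rw [← eggMeasure_eq_add hω₁ hlam₁ ha₁ hb₁ hc₁, ← eggMeasure_eq_add hω₂ hlam₂ ha₂ hb₂ hc₂]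
    at hmi hme
  have hint : Integrable (fun ω => capacityLog (τ * μ₁) (C / μ₂) r₁ r₂ (I₁ ω, I₂ ω)) P := by
    rw [← hlaw.map_eq] at hmi
    exact hmi.comp_aemeasurable hlaw.aemeasurable
  -- With `x = τ μ₁` and `y = C / μ₂` fixed, the four terms differ only in the scales `λ` or `b` and
  -- in the shape parameters.
  have ex : ∀ d : ℝ, τ * d ^ r₁ * μ₁ = τ * μ₁ * d ^ r₁ := fun d => by ring
  have ey : ∀ d : ℝ, C / (d ^ r₂ * μ₂) = C / μ₂ / d ^ r₂ := fun d => by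
    rw [div_div, mul_comm]
  simp only [ex, ey, capacitySecondExp_eq]
  have h₁₁ := (isBivariateFoxH_capacityGG one_pos hlam₁ one_pos one_pos hlam₂ one_pos hx hy
    r₁ r₂).congr_left (capacityFirstExp_kernel r₁) (capacityFirstExp_separates r₁)
  have h₁₂ := (isBivariateFoxH_capacityGG one_pos hlam₁ one_pos ha₂ hb₂ hc₂ hx hy
    r₁ r₂).congr_left (capacityFirstExp_kernel r₁) (capacityFirstExp_separates r₁)
  have h₂₁ := isBivariateFoxH_capacityGG ha₁ hb₁ hc₁ one_pos hlam₂ one_pos hx hy r₁ r₂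
  have h₂₂ := isBivariateFoxH_capacityGG ha₁ hb₁ hc₁ ha₂ hb₂ hc₂ hx hy r₁ r₂
  refine ⟨hint.congr hlog, ⟨_, h₁₁⟩, ⟨_, h₁₂⟩, ⟨_, h₂₁⟩,
    ⟨_, h₂₂⟩, ?_⟩
  have hG₁ : (Real.Gamma a₁ : ℂ) ≠ 0 := Complex.ofReal_ne_zero.2 (Real.Gamma_pos_of_pos ha₁).ne'
  have hG₂ : (Real.Gamma a₂ : ℂ) ≠ 0 := Complex.ofReal_ne_zero.2 (Real.Gamma_pos_of_pos ha₂).ne'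
  -- Each Fox H value is `Γ(a) Γ(a')` times a capacity, with first arguments `1` for exponential
  -- components; the prefactors remove these gammas.
  rw [h₁₁.bivariateFoxH_eq, h₁₂.bivariateFoxH_eq, h₂₁.bivariateFoxH_eq, h₂₂.bivariateFoxH_eq,
    ← integral_congr_ae hlog]
  have hE := hlaw.integral_comp hmeas
  simp only [Function.comp_def] at hE
  rw [hE, hme, Real.Gamma_one]
  push_cast
  field_simp
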